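/- Fix integers $r, n_1, n_2 \ge 1$ and equip $\mathbb{R}^{n_1\times n_2\times 2}$ with the Frobenius norm. Let $\mathcal S$ be the set of nonzero tensors $a\otimes b\otimes z$, let $\Phi_r(\mathcal A_1,\dots,\mathcal A_r)=\mathcal A_1+\cdots+\mathcal A_r$ on $\mathcal S^{\times r}$, and let $\sigma_r$ be the set of tensors of rank at most $r$. Let $\mathcal M\subset\mathcal S^{\times r}$ be the set of tuples $\mathfrak a=(\mathcal A_1,\dots,\mathcal A_r)$, $\mathcal A_i=a_i\otimes b_i\otimes z_i$, such that (i) $\Phi_r(\mathfrak a)$ is a smooth point of the Zariski closure of $\sigma_r$; (ii) $\Phi_r(\mathfrak a)$ has rank $r$ and $\{\mathcal A_1,\dots,\mathcal A_r\}$ is the only set of $r$ rank-one tensors with this sum; (iii) $\Phi_r$ has a continuous local inverse $\Phi_{\mathfrak a}^{-1}$ at $\mathfrak a$, and $\limsup_{\mathcal T\to\Phi_r(\mathfrak a)} \|\mathfrak a-\Phi_{\mathfrak a}^{-1}(\mathcal T)\|_F/\|\Phi_r(\mathfrak a)-\mathcal T\|_F<\infty$; (iv) for every nonempty set of the three factors,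 the $r$ tensor products of these factors are in general linear position (in a space of dimension $m$, every $\min\{r,m\}$ of the $r$ vectors are linearly independent); (v) the $(1,1,1)$-entry of every $\mathcal A_i$ is nonzero. The $r$-nice tensors are $\mathcal N=\Phi_r(\mathcal M)$. Let $\tau:\mathcal N\to\mathcal M/\mathfrak S_r$ be the map $\mathcal A_1+\cdots+\mathcal A_r\mapsto\{\mathcal A_1,\dots,\mathcal A_r\}$. Let $S$ be the set of $r$-tuples of unit vectors of $\mathbb{R}^{n_1}$ with positive first coordinate that form an $n_1\times r$ matrix of full rank, and let $\widehat\theta:\mathcal N\to S/\mathfrak S_r$ be the map $\sum_i a_i\otimes b_i\otimes z_i\mapsto\{a_1,\dots,a_r\}$, where the decomposition is the $r$-nice one, with the $a_i$ normalized so that $(a_1,\dots,a_r)\in S$. For $f=\tau$ or $f=\widehat\theta$ let $\kappa[f](\mathcal B)\in[0,\infty]$ be the condition number, i.e. the supremum over the nonzero tangent vectors $t$ of $\mathcal N$ at $\mathcal B$ of $\|(\mathrm d_{\mathcal B}f)(t)\|/\|t\|$; here the metrics on $\mathcal N$, $\mathcal M$ and $S$ are inherited from the ambient Euclidean spaces,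 and the quotients $\mathcal M/\mathfrak S_r$ and $S/\mathfrak S_r$ carry the metrics for which the projections from $\mathcal M$ and $S$ are local isometries. **Lemma.** There is a constant $\nu_0>0$ such that the following holds for all $0<\nu\le\nu_0$ and all $r,n_1,n_2\ge1$. Let $\mathcal B=\sum_{i=1}^r a_i\otimes b_i\otimes z_i\in\mathcal N$ with $\|a_i\|=1$ and $\|b_i\otimes z_i\|<1+\nu$ for $i=1,\dots,r$, and let $A=[a_i]_i\in\mathbb{R}^{n_1\times r}$. If there is a matrix $A'\in\mathbb{R}^{n_1\times r}$ with orthonormal columns such that $\|A-A'\|_F\le\nu$, then $$\kappa[\widehat\theta](\mathcal B)\;\ge\;\frac{\kappa[\tau](\mathcal B)}{10r}-1.$$ -/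

import Mathlib

open Set Filter Topology
open scoped ContDiff ENNReal

noncomputable section

namespace PBA

/-! ### Tensors, tuples and unordered tuples -/

/-- Real `n₁ × n₂ × n₃` arrays, with the Frobenius (Euclidean) inner product. -/
abbrev Tensor (n₁ n₂ n₃ : ℕ) : Type := EuclideanSpace ℝ (Fin n₁ × Fin n₂ × Fin n₃)

/-- Ordered `r`-tuples of elements of `E`, with the Euclidean product structure, so that
`‖x‖ ^ 2 = ∑ i, ‖x i‖ ^ 2`.  For `E = ℝⁿ` these are the `n × r` matrices (given by their columns)
with the Frobenius norm. -/
abbrev Tuple (r : ℕ) (E : Type) : Type := PiLp 2 (fun _ : Fin r => E)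

/-- The unordered tuple `{x 1, …, x r}`, i.e. the class of `x` modulo permutations of the index
set (`unord_eq_unord_iff`). -/
def unord {r : ℕ} {E : Type} (x : Tuple r E) : Multiset E :=
  Finset.univ.val.map (fun i => x i)

theorem unord_eq_unord_iff {r : ℕ} {E : Type} (x y : Tuple r E) :
    unord x = unord y ↔ ∃ σ : Equiv.Perm (Fin r), ∀ i, x i = y (σ i) := by
  classical
  constructor
  · intro h
    have hc : ∀ v, Nonempty ({i // x i = v} ≃ {i // y i = v}) := fun v => by
      have h1 := congrArg (Multiset.count v) h
      rw [unord, unord, Multiset.count_map, Multiset.count_map] at h1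
      refine ⟨Fintype.equivOfCardEq ?_⟩
      rw [Fintype.card_subtype, Fintype.card_subtype]
      simpa [Finset.card_def, Finset.filter_val, eq_comm] using h1
    let e := fun v => Classical.choice (hc v)
    exact ⟨Equiv.ofFiberEquiv e, fun i => (Equiv.ofFiberEquiv_map e i).symm⟩
  · rintro ⟨σ, hσ⟩
    have h1 : (fun i => x i) = (fun i => y i) ∘ σ := funext hσ
    have h2 : (Finset.univ : Finset (Fin r)).val.map (σ : Fin r → Fin r) = Finset.univ.val := by
      simp
    unfold unord
    rw [h1, ← Multiset.map_map, h2]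

/-- The rank-one array `b ⊗ c`. -/
def outer₂ {m n : ℕ} (b : EuclideanSpace ℝ (Fin m)) (c : EuclideanSpace ℝ (Fin n)) :
    EuclideanSpace ℝ (Fin m × Fin n) :=
  WithLp.toLp 2 fun p => b p.1 * c p.2

/-- The array `a ⊗ b ⊗ c`. -/
def outer₃ {n₁ n₂ n₃ : ℕ} (a : EuclideanSpace ℝ (Fin n₁)) (b : EuclideanSpace ℝ (Fin n₂))
    (c : EuclideanSpace ℝ (Fin n₃)) : Tensor n₁ n₂ n₃ :=
  WithLp.toLp 2 fun p => a p.1 * b p.2.1 * c p.2.2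

/-- The Segre manifold of rank-one tensors (zero excluded). -/
def segre (n₁ n₂ n₃ : ℕ) : Set (Tensor n₁ n₂ n₃) :=
  {T | T ≠ 0 ∧ ∃ a b c, T = outer₃ a b c}

/-- The addition map on `r`-tuples of tensors. -/
def addMap {r n₁ n₂ n₃ : ℕ} (x : Tuple r (Tensor n₁ n₂ n₃)) : Tensor n₁ n₂ n₃ := ∑ i, x i

/-- `r`-tuples of rank-one tensors. -/
def segreTuples (r n₁ n₂ n₃ : ℕ) : Set (Tuple r (Tensor n₁ n₂ n₃)) :=
  {x | ∀ i, x i ∈ segre n₁ n₂ n₃}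

/-- The set of tensors of rank at most `r`. -/
def rankLE (r n₁ n₂ n₃ : ℕ) : Set (Tensor n₁ n₂ n₃) :=
  {T | ∃ (a : Fin r → EuclideanSpace ℝ (Fin n₁)) (b : Fin r → EuclideanSpace ℝ (Fin n₂))
    (c : Fin r → EuclideanSpace ℝ (Fin n₃)), T = ∑ i, outer₃ (a i) (b i) (c i)}

/-! ### Smooth points of the secant variety -/

/-- The smallest real algebraic subset of coordinate space that contains `X`. -/
def zariskiClosure {ι : Type} (X : Set (EuclideanSpace ℝ ι)) : Set (ι → ℝ) :=
  MvPolynomial.zeroLocus ℝ (MvPolynomial.vanishingIdeal ℝ (WithLp.ofLp '' X))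

/-- The Zariski tangent space at `x` of a set `V` in coordinate space: the common kernel of the
differentials at `x` of all polynomials vanishing on `V`. -/
def zariskiTangentSpace {ι : Type} [Fintype ι] (V : Set (ι → ℝ)) (x : ι → ℝ) :
    Submodule ℝ (ι → ℝ) where
  carrier := {v | ∀ p ∈ MvPolynomial.vanishingIdeal ℝ V,
    ∑ i, MvPolynomial.eval x (MvPolynomial.pderiv i p) * v i = 0}
  zero_mem' := by intro p _; simp
  add_mem' := by
    intro v w hv hw p hp
    have h1 := hv p hp
    have h2 := hw p hp
    simp only [Pi.add_apply, mul_add, Finset.sum_add_distrib, h1, h2, add_zero]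
  smul_mem' := by
    intro c v hv p hp
    have h1 := hv p hp
    simp only [Pi.smul_apply, smul_eq_mul, mul_left_comm _ c, ← Finset.mul_sum, h1, mul_zero]

/-- `x` is a smooth point of the irreducible real algebraic set `V`: the dimension of the Zariski
tangent space at `x` equals the dimension of `V` (the Krull dimension of its coordinate ring). -/
def IsSmoothPoint {ι : Type} [Fintype ι] (V : Set (ι → ℝ)) (x : ι → ℝ) : Prop :=
  x ∈ V ∧ ((Module.finrank ℝ (zariskiTangentSpace V x) : ℕ) : WithBot ℕ∞) =
    ringKrullDim (MvPolynomial ι ℝ ⧸ MvPolynomial.vanishingIdeal ℝ V)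

/-! ### Identifiability, general linear position -/

/-- `T` has rank exactly `r`, and the set of `r` rank-one tensors with sum `T` is unique. -/
def IsIdentifiable (r : ℕ) {n₁ n₂ n₃ : ℕ} (T : Tensor n₁ n₂ n₃) : Prop :=
  (∀ s < r, T ∉ rankLE s n₁ n₂ n₃) ∧
  ∃! s : Multiset (Tensor n₁ n₂ n₃), ∃ x ∈ segreTuples r n₁ n₂ n₃, addMap x = T ∧ unord x = s

/-- General linear position: any `min r (dim E)` of the `r` vectors are linearly independent. -/
def IsGLP {r : ℕ} {E : Type} [AddCommGroup E] [Module ℝ E] (p : Fin r → E) : Prop :=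
  ∀ s : Finset (Fin r), s.card = min r (Module.finrank ℝ E) →
    LinearIndependent ℝ (fun i : s => p i)

/-- Super general linear position of a tuple of rank-one tensors: for each non-empty set of factors,
the partial tensor products are in general linear position.  (The factors of a rank-one tensor are
unique up to scaling, which does not affect general linear position.) -/
def IsSGLP {r n₁ n₂ n₃ : ℕ} (x : Tuple r (Tensor n₁ n₂ n₃)) : Prop :=
  ∃ (a : Fin r → EuclideanSpace ℝ (Fin n₁)) (b : Fin r → EuclideanSpace ℝ (Fin n₂))
    (c : Fin r → EuclideanSpace ℝ (Fin n₃)),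
    (∀ i, x i = outer₃ (a i) (b i) (c i)) ∧
    IsGLP a ∧ IsGLP b ∧ IsGLP c ∧
    IsGLP (fun i => outer₂ (a i) (b i)) ∧ IsGLP (fun i => outer₂ (a i) (c i)) ∧
    IsGLP (fun i => outer₂ (b i) (c i)) ∧
    IsGLP (fun i => outer₃ (a i) (b i) (c i))

/-! ### The condition number of an ordered decomposition -/

/-- `ψ : D → segreTuples` is a continuous local inverse of the addition map at the tuple `x`: it is
inverse to the restriction of the addition map to a neighbourhood of `x` among tuples of
rank-one tensors, and `D` is the image of that neighbourhood. -/
def IsLocalInverse {r n₁ n₂ n₃ : ℕ} (x : Tuple r (Tensor n₁ n₂ n₃)) (D : Set (Tensor n₁ n₂ n₃))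
    (ψ : Tensor n₁ n₂ n₃ → Tuple r (Tensor n₁ n₂ n₃)) : Prop :=
  ∃ U : Set (Tuple r (Tensor n₁ n₂ n₃)), IsOpen U ∧ x ∈ U ∧
    D = addMap '' (U ∩ segreTuples r n₁ n₂ n₃) ∧
    (∀ y ∈ U ∩ segreTuples r n₁ n₂ n₃, ψ (addMap y) = y) ∧ ContinuousOn ψ D

/-- The condition number of the ordered decomposition `x` of `T = addMap x`:
`lim_{ε → 0} sup_{‖T - T'‖ < ε} ‖ψ T - ψ T'‖ / ‖T - T'‖` with `ψ` the local inverse of the addition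
map at `x`, and `∞` if there is no local inverse.  (Any two local inverses agree near `T` on the
image of a small neighbourhood of `x`, so the infimum only encodes the convention `∞`.) -/
def cpdCond {r n₁ n₂ n₃ : ℕ} (x : Tuple r (Tensor n₁ n₂ n₃)) : ℝ≥0∞ :=
  ⨅ (D : Set (Tensor n₁ n₂ n₃)) (ψ : Tensor n₁ n₂ n₃ → Tuple r (Tensor n₁ n₂ n₃))
    (_ : IsLocalInverse x D ψ),
    limsup (fun T' => ‖ψ (addMap x) - ψ T'‖ₑ / ‖addMap x - T'‖ₑ)
      (𝓝[D \ {addMap x}] (addMap x))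

/-! ### Nice tensors and the tensor decomposition map -/

/-- The ordered `r`-nice decompositions. -/
def niceTuples (r n₁ n₂ n₃ : ℕ) [NeZero n₁] [NeZero n₂] [NeZero n₃] :
    Set (Tuple r (Tensor n₁ n₂ n₃)) :=
  {x | x ∈ segreTuples r n₁ n₂ n₃ ∧
    IsSmoothPoint (zariskiClosure (rankLE r n₁ n₂ n₃)) (WithLp.ofLp (addMap x)) ∧
    IsIdentifiable r (addMap x) ∧
    cpdCond x < ⊤ ∧
    IsSGLP x ∧
    ∀ i, x i (0, 0, 0) ≠ 0}

/-- The `r`-nice tensors. -/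
def niceTensors (r n₁ n₂ n₃ : ℕ) [NeZero n₁] [NeZero n₂] [NeZero n₃] : Set (Tensor n₁ n₂ n₃) :=
  addMap '' niceTuples r n₁ n₂ n₃

open Classical in
/-- The tensor decomposition map `T₁ + ⋯ + T_r ↦ {T₁, …, T_r}` on the `r`-nice tensors, with values
in the `r`-nice tuples modulo permutations (see `tdm_addMap`; the value `0` outside of the nice
tensors is irrelevant). -/
def tdm (r : ℕ) {n₁ n₂ n₃ : ℕ} [NeZero n₁] [NeZero n₂] [NeZero n₃] (T : Tensor n₁ n₂ n₃) :
    Multiset (Tensor n₁ n₂ n₃) :=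
  if h : ∃ x ∈ niceTuples r n₁ n₂ n₃, addMap x = T then unord h.choose else 0

theorem unord_eq_of_addMap_eq {r n₁ n₂ n₃ : ℕ} [NeZero n₁] [NeZero n₂] [NeZero n₃]
    {x y : Tuple r (Tensor n₁ n₂ n₃)} (hx : x ∈ niceTuples r n₁ n₂ n₃)
    (hy : y ∈ segreTuples r n₁ n₂ n₃) (h : addMap y = addMap x) : unord y = unord x := by
  obtain ⟨s, -, hs⟩ := hx.2.2.1.2
  exact (hs _ ⟨y, hy, h, rfl⟩).trans (hs _ ⟨x, hx.1, rfl, rfl⟩).symm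

theorem tdm_addMap {r n₁ n₂ n₃ : ℕ} [NeZero n₁] [NeZero n₂] [NeZero n₃]
    {x : Tuple r (Tensor n₁ n₂ n₃)} (hx : x ∈ niceTuples r n₁ n₂ n₃) :
    tdm r (addMap x) = unord x := by
  have h : ∃ y ∈ niceTuples r n₁ n₂ n₃, addMap y = addMap x := ⟨x, hx, rfl⟩
  rw [tdm, dif_pos h]
  exact unord_eq_of_addMap_eq hx h.choose_spec.1.1 h.choose_spec.2

/-! ### Recovery of the first factor matrix -/

/-- The open upper half of the unit sphere: unit vectors with positive first coordinate. -/
def upperSphere (n : ℕ) [NeZero n] : Set (EuclideanSpace ℝ (Fin n)) :=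
  {u | ‖u‖ = 1 ∧ 0 < u 0}

/-- `r`-tuples in the upper half sphere that form an `n × r` matrix of full rank. -/
def factorTuples (r n : ℕ) [NeZero n] : Set (Tuple r (EuclideanSpace ℝ (Fin n))) :=
  {s | (∀ i, s i ∈ upperSphere n) ∧
    Module.finrank ℝ (Submodule.span ℝ (Set.range fun i => s i)) = min r n}

open Classical in
/-- The map `∑ i, aᵢ ⊗ bᵢ ⊗ zᵢ ↦ {a₁, …, a_r}` on the `r`-nice tensors, where the `aᵢ` are taken
in the upper half sphere (see
`theta_addMap` and `exists_factorTuples`; the value `0` outside of the nice tensors is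
irrelevant). -/
def theta (r : ℕ) {n₁ n₂ n₃ : ℕ} [NeZero n₁] [NeZero n₂] [NeZero n₃] (T : Tensor n₁ n₂ n₃) :
    Multiset (EuclideanSpace ℝ (Fin n₁)) :=
  if h : ∃ a ∈ factorTuples r n₁, ∃ x ∈ niceTuples r n₁ n₂ n₃,
      (∀ i, ∃ b c, x i = outer₃ (a i) b c) ∧ addMap x = T
  then unord h.choose else 0

theorem outer₃_left_injective {n₁ n₂ n₃ : ℕ} [NeZero n₁]
    {a a' : EuclideanSpace ℝ (Fin n₁)} {b b' : EuclideanSpace ℝ (Fin n₂)}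
    {c c' : EuclideanSpace ℝ (Fin n₃)} (ha : a ∈ upperSphere n₁) (ha' : a' ∈ upperSphere n₁)
    (h0 : outer₃ a b c ≠ 0) (h : outer₃ a b c = outer₃ a' b' c') : a = a' := by
  have hp : ∀ i j k, a i * b j * c k = a' i * b' j * c' k := fun i j k => by
    have := congrArg (fun T : Tensor n₁ n₂ n₃ => T (i, j, k)) h
    simpa [outer₃] using this
  obtain ⟨j, k, hjk⟩ : ∃ j k, b j * c k ≠ 0 := by
    by_contra! hc
    apply h0
    ext ⟨i, j, k⟩
    simp [outer₃, mul_assoc, hc j k]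
  -- `a` and `a'` are proportional with a positive factor `t`
  set t : ℝ := (b' j * c' k) / (b j * c k) with ht
  have hat : ∀ i, a i = t * a' i := fun i => by
    have := hp i j k
    rw [ht, div_mul_eq_mul_div, eq_div_iff hjk]
    linarith
  have hvec : a = t • a' := by
    ext i
    simpa using hat i
  have htpos : 0 < t := by
    have h1 := hat 0
    have h2 := ha.2
    rw [h1] at h2
    exact pos_of_mul_pos_left h2 ha'.2.le
  have hn := ha.1
  rw [hvec, norm_smul, ha'.1, mul_one, Real.norm_of_nonneg htpos.le] at hn
  rw [hvec, hn, one_smul]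

theorem IsGLP.finrank_span {r : ℕ} {E : Type} [AddCommGroup E] [Module ℝ E]
    [FiniteDimensional ℝ E] {p : Fin r → E} (hp : IsGLP p) :
    Module.finrank ℝ (Submodule.span ℝ (Set.range p)) = min r (Module.finrank ℝ E) := by
  apply le_antisymm
  · exact le_min ((finrank_range_le_card p).trans (by simp)) (Submodule.finrank_le _)
  · obtain ⟨s, -, hs⟩ := Finset.exists_subset_card_eq
      (s := (Finset.univ : Finset (Fin r))) (n := min r (Module.finrank ℝ E)) (by simp)
    have h1 := finrank_span_eq_card (hp s hs)
    rw [Fintype.card_coe, hs] at h1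
    rw [← h1]
    refine Submodule.finrank_mono (Submodule.span_mono ?_)
    rintro _ ⟨i, rfl⟩
    exact ⟨i, rfl⟩

/-- Each nice tuple has first factors in the upper half sphere, and they form a matrix of full
rank. -/
theorem exists_factorTuples {r n₁ n₂ n₃ : ℕ} [NeZero n₁] [NeZero n₂] [NeZero n₃]
    {x : Tuple r (Tensor n₁ n₂ n₃)} (hx : x ∈ niceTuples r n₁ n₂ n₃) :
    ∃ a ∈ factorTuples r n₁, ∀ i, ∃ b c, x i = outer₃ (a i) b c := by
  obtain ⟨-, -, -, -, ⟨p, q, t, hx', hp, -⟩, h0⟩ := hx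
  have hp0 : ∀ i, p i 0 ≠ 0 := fun i h => h0 i (by rw [hx' i]; simp [outer₃, h])
  have hpn : ∀ i, ‖p i‖ ≠ 0 := fun i h => hp0 i (by rw [norm_eq_zero.1 h]; rfl)
  -- normalising scalars
  let l : Fin r → ℝ := fun i => SignType.sign (p i 0) * ‖p i‖⁻¹
  have hl : ∀ i, l i ≠ 0 := fun i =>
    mul_ne_zero (by rcases lt_or_gt_of_ne (hp0 i) with h | h <;> simp [h]) (inv_ne_zero (hpn i))
  refine ⟨WithLp.toLp 2 fun i => l i • p i, ⟨fun i => ⟨?_, ?_⟩, ?_⟩, fun i =>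
    ⟨(l i)⁻¹ • q i, t i, ?_⟩⟩
  · rcases lt_or_gt_of_ne (hp0 i) with h | h <;> simp [l, h, norm_smul, hpn i]
  · have hpos : 0 < ‖p i‖ := (norm_nonneg _).lt_of_ne' (hpn i)
    have : 0 < |p i 0| * ‖p i‖⁻¹ := mul_pos (abs_pos.2 (hp0 i)) (inv_pos.2 hpos)
    rw [← sign_mul_self] at this
    simp only [l, PiLp.smul_apply, smul_eq_mul]
    linarith
  · have hspan : Submodule.span ℝ (Set.range fun i => l i • p i) =
        Submodule.span ℝ (Set.range p) := by
      apply le_antisymm <;> rw [Submodule.span_le] <;> rintro _ ⟨i, rfl⟩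
      · exact Submodule.smul_mem _ _ (Submodule.subset_span ⟨i, rfl⟩)
      · have := Submodule.smul_mem (Submodule.span ℝ (Set.range fun i => l i • p i)) (l i)⁻¹
          (Submodule.subset_span ⟨i, rfl⟩)
        simpa [smul_smul, hl i] using this
    change Module.finrank ℝ (Submodule.span ℝ (Set.range fun i => l i • p i)) = _
    rw [hspan, hp.finrank_span, finrank_euclideanSpace_fin]
  · rw [hx' i]
    ext ⟨j, k, m⟩
    have := hl i
    simp only [outer₃, PiLp.smul_apply, smul_eq_mul]
    field_simp

theorem theta_addMap {r n₁ n₂ n₃ : ℕ} [NeZero n₁] [NeZero n₂] [NeZero n₃]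
    {a : Tuple r (EuclideanSpace ℝ (Fin n₁))} (ha : a ∈ factorTuples r n₁)
    {x : Tuple r (Tensor n₁ n₂ n₃)} (hx : x ∈ niceTuples r n₁ n₂ n₃)
    (hax : ∀ i, ∃ b c, x i = outer₃ (a i) b c) :
    theta r (addMap x) = unord a := by
  have h : ∃ a' ∈ factorTuples r n₁, ∃ y ∈ niceTuples r n₁ n₂ n₃,
      (∀ i, ∃ b c, y i = outer₃ (a' i) b c) ∧ addMap y = addMap x := ⟨a, ha, x, hx, hax, rfl⟩
  rw [theta, dif_pos h]
  obtain ⟨ha', y, hy, hay, hyx⟩ := h.choose_spec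
  obtain ⟨σ, hσ⟩ := (unord_eq_unord_iff y x).1 (unord_eq_of_addMap_eq hx hy.1 hyx)
  refine (unord_eq_unord_iff _ _).2 ⟨σ, fun i => ?_⟩
  obtain ⟨b, c, h1⟩ := hay i
  obtain ⟨b', c', h2⟩ := hax (σ i)
  refine outer₃_left_injective (ha'.1 i) (ha.1 (σ i)) (b := b) (c := c) (b' := b') (c' := c') ?_ ?_
  · rw [← h1]
    exact (hy.1 i).1
  · rw [← h1, ← h2]
    exact hσ i

/-! ### Condition numbers of maps into unordered tuples -/

/-- `γ` is a smooth curve in `M`, defined on an open interval around `0`, with `γ 0 = x` and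
`γ' 0 = v`. -/
def IsCurve {E : Type} [NormedAddCommGroup E] [NormedSpace ℝ E] (M : Set E) (x v : E)
    (γ : ℝ → E) : Prop :=
  γ 0 = x ∧ HasDerivAt γ v 0 ∧
    ∃ ε > 0, ContDiffOn ℝ ∞ γ (Ioo (-ε) ε) ∧ ∀ t ∈ Ioo (-ε) ε, γ t ∈ M

/-- The tangent space of `M` at `x`: the velocities at `x` of the smooth curves in `M`. -/
def tangentSpace {E : Type} [NormedAddCommGroup E] [NormedSpace ℝ E] (M : Set E) (x : E) : Set E :=
  {v | ∃ γ, IsCurve M x v γ}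

/-- The length of the velocity at time `0` of a curve `f` of unordered tuples in `P` modulo
permutations, for the metric for which the projection `P → P / 𝔖_r` is a local isometry: it is
the norm of the velocity `w` of a smooth lift of `f` to a curve `c` of ordered tuples in `P`.
It is `∞` if `f` has no smooth lift near `0` (i.e. `f` is not smooth at `0`). -/
def unordSpeed {r : ℕ} {F : Type} [NormedAddCommGroup F] [NormedSpace ℝ F] (P : Set (Tuple r F))
    (f : ℝ → Multiset F) : ℝ≥0∞ :=
  ⨅ (w : Tuple r F) (_ : ∃ (y : Tuple r F) (c : ℝ → Tuple r F), IsCurve P y w c ∧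
    ∀ᶠ t in 𝓝 0, unord (c t) = f t), ‖w‖ₑ

/-- The norm of the derivative at `x` of `f : M → P / 𝔖_r` applied to a tangent vector `v`: the
length of the velocity at time `0` of `f ∘ γ` for a smooth curve `γ` in `M` through `x` with
velocity `v` (for smooth `f` the choice of `γ` does not matter). -/
def derivNorm {r : ℕ} {E F : Type} [NormedAddCommGroup E] [NormedSpace ℝ E] [NormedAddCommGroup F]
    [NormedSpace ℝ F] (M : Set E) (P : Set (Tuple r F)) (f : E → Multiset F) (x v : E) : ℝ≥0∞ :=
  ⨆ (γ : ℝ → E) (_ : IsCurve M x v γ), unordSpeed P (fun t => f (γ t))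

/-- The condition number at `x` of a map `f : M → P / 𝔖_r`: the maximum over nonzero tangent
vectors `v` of `M` at `x` of the norm of the derivative of `f` in direction `v` over the norm
of `v`. -/
def cond {r : ℕ} {E F : Type} [NormedAddCommGroup E] [NormedSpace ℝ E] [NormedAddCommGroup F]
    [NormedSpace ℝ F] (M : Set E) (P : Set (Tuple r F)) (f : E → Multiset F) (x : E) : ℝ≥0∞ :=
  ⨆ (v : E) (_ : v ∈ tangentSpace M x) (_ : v ≠ 0), derivNorm M P f x v / ‖v‖ₑ

/-- The condition number of the tensor decomposition map. -/
def condTdm (r : ℕ) {n₁ n₂ n₃ : ℕ} [NeZero n₁] [NeZero n₂] [NeZero n₃] (T : Tensor n₁ n₂ n₃) :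
    ℝ≥0∞ :=
  cond (niceTensors r n₁ n₂ n₃) (niceTuples r n₁ n₂ n₃) (tdm r) T

/-- The condition number of the recovery of the first factor matrix on the nice tensors. -/
def condTheta (r : ℕ) {n₁ n₂ n₃ : ℕ} [NeZero n₁] [NeZero n₂] [NeZero n₃] (T : Tensor n₁ n₂ n₃) :
    ℝ≥0∞ :=
  cond (niceTensors r n₁ n₂ n₃) (factorTuples r n₁) (theta r) T

end PBA

end

/-! Write a decomposition as `aᵢ ⊗ Nᵢ` with unit vectors `aᵢ` and matrices `Nᵢ`. For orthonormal
`aᵢ` the map `K ↦ ∑ aᵢ ⊗ Kᵢ` is an isometry, so near-orthonormal `aᵢ` determine the `Kᵢ` stably from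
the sum (`norm_le_of_near_orthonormal`): instability of the decomposition must show up in the first
factors.

Along a curve of nice tensors with velocity `v`, let `u` and `K` be the velocities of `a` and `N`.
The decomposition moves with velocity `(aᵢ ⊗ Kᵢ + uᵢ ⊗ Nᵢ)ᵢ`, whose entries sum to `v`. Hence `∑ aᵢ
⊗ Kᵢ = v - ∑ uᵢ ⊗ Nᵢ`, which bounds `‖K‖` in terms of `‖u‖` and `‖v‖`, and the whole velocity by `10
r (‖u‖ + ‖v‖)` (`norm_variation_le`). Dividing by `‖v‖` and taking suprema gives `κ[τ] ≤ 10 r (κ[θ]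
+ 1)`.

Speeds are defined by smooth lifts, so a lift of the first factors has to be extended to a lift of
the decomposition. Here `N` solves a linear system that is injective at time `0`, hence it depends
smoothly on time (`exists_contDiffOn_solution`, `unordSpeed_tdm_le`). The lift may order the factors
differently and flip signs; by identifiability nothing else can differ, and the hypotheses survive
both changes (`near_orthonormal_of_decomposition`). -/

noncomputable section

namespace PBA

/-! ### The outer product of a vector and a matrix -/

/-- The outer product of a vector and a matrix, as a continuous bilinear map. -/
def outerL (n₁ n₂ n₃ : ℕ) : EuclideanSpace ℝ (Fin n₁) →L[ℝ]
    EuclideanSpace ℝ (Fin n₂ × Fin n₃) →L[ℝ] Tensor n₁ n₂ n₃ :=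
  LinearMap.toContinuousLinearMap
    ((LinearMap.toContinuousLinearMap (𝕜 := ℝ)
      (E := EuclideanSpace ℝ (Fin n₂ × Fin n₃)) (F' := Tensor n₁ n₂ n₃)).toLinearMap ∘ₗ
      LinearMap.mk₂ ℝ (fun (a : EuclideanSpace ℝ (Fin n₁))
        (N : EuclideanSpace ℝ (Fin n₂ × Fin n₃)) =>
          (WithLp.toLp 2 fun p => a p.1 * N p.2 : Tensor n₁ n₂ n₃))
        (fun a b N => by ext p; simp [add_mul])
        (fun c a N => by ext p; simp [mul_assoc])
        (fun a M N => by ext p; simp [mul_add])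
        (fun c a N => by ext p; simp [mul_left_comm]))

variable {r n₁ n₂ n₃ : ℕ}

@[simp]
theorem outerL_apply (a : EuclideanSpace ℝ (Fin n₁)) (N : EuclideanSpace ℝ (Fin n₂ × Fin n₃))
    (p : Fin n₁ × Fin n₂ × Fin n₃) : outerL n₁ n₂ n₃ a N p = a p.1 * N p.2 := rfl

theorem outer₃_eq_outerL (a : EuclideanSpace ℝ (Fin n₁)) (b : EuclideanSpace ℝ (Fin n₂))
    (c : EuclideanSpace ℝ (Fin n₃)) : outer₃ a b c = outerL n₁ n₂ n₃ a (outer₂ b c) := by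
  ext p
  simp [outer₃, outer₂, mul_assoc]

theorem inner_outerL (a a' : EuclideanSpace ℝ (Fin n₁))
    (N N' : EuclideanSpace ℝ (Fin n₂ × Fin n₃)) :
    inner ℝ (outerL n₁ n₂ n₃ a N) (outerL n₁ n₂ n₃ a' N') = inner ℝ a a' * inner ℝ N N' := by
  simp only [PiLp.inner_apply, outerL_apply, RCLike.inner_apply, conj_trivial]
  rw [Finset.sum_mul_sum, ← Finset.univ_product_univ, Finset.sum_product]
  exact Finset.sum_congr rfl fun i _ => Finset.sum_congr rfl fun j _ => by ring

theorem norm_outerL (a : EuclideanSpace ℝ (Fin n₁)) (N : EuclideanSpace ℝ (Fin n₂ × Fin n₃)) :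
    ‖outerL n₁ n₂ n₃ a N‖ = ‖a‖ * ‖N‖ := by
  have h := inner_outerL a a N N
  simp only [real_inner_self_eq_norm_sq, ← mul_pow] at h
  exact (sq_eq_sq₀ (norm_nonneg _) (by positivity)).1 h

/-- Unit vectors that are first factors of the same nonzero rank-one tensor agree up to sign. -/
theorem eq_smul_of_outerL_eq {a a' : EuclideanSpace ℝ (Fin n₁)}
    {N N' : EuclideanSpace ℝ (Fin n₂ × Fin n₃)} (ha : ‖a‖ = 1) (ha' : ‖a'‖ = 1)
    (hN : N ≠ 0) (h : outerL n₁ n₂ n₃ a N = outerL n₁ n₂ n₃ a' N') :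
    ∃ s : ℝ, s * s = 1 ∧ a = s • a' := by
  obtain ⟨q, hq⟩ : ∃ q, N q ≠ 0 := by
    by_contra! hc
    exact hN (by ext q; simpa using hc q)
  -- Compare the two tensors on the fibre over one `q` with `N q ≠ 0`. Both vectors have norm one,
  -- so the scalar is `±1`.
  have hvec : a = (N' q / N q) • a' := by
    ext i
    have := congrArg (fun T : Tensor n₁ n₂ n₃ => T (i, q)) h
    simp only [outerL_apply] at this
    simp only [PiLp.smul_apply, smul_eq_mul]
    field_simp
    linarith
  refine ⟨N' q / N q, ?_, hvec⟩
  have hn := ha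
  rw [hvec, norm_smul, ha', mul_one, Real.norm_eq_abs] at hn
  rw [← abs_mul_abs_self, hn, one_mul]

/-- The map `N ↦ ∑ i, aᵢ ⊗ Nᵢ`, linear also in the tuple `a`. -/
def sumOuterL (r n₁ n₂ n₃ : ℕ) : Tuple r (EuclideanSpace ℝ (Fin n₁)) →L[ℝ]
    Tuple r (EuclideanSpace ℝ (Fin n₂ × Fin n₃)) →L[ℝ] Tensor n₁ n₂ n₃ :=
  ∑ i, (outerL n₁ n₂ n₃).bilinearComp (PiLp.proj 2 _ i) (PiLp.proj 2 _ i)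

@[simp]
theorem sumOuterL_apply (a : Tuple r (EuclideanSpace ℝ (Fin n₁)))
    (N : Tuple r (EuclideanSpace ℝ (Fin n₂ × Fin n₃))) :
    sumOuterL r n₁ n₂ n₃ a N = ∑ i, outerL n₁ n₂ n₃ (a i) (N i) := by
  simp [sumOuterL]

/-- On the fibre over each `q`, a vanishing sum is a linear relation among the `a j` with
coefficients `N j q`. -/
theorem sumOuterL_injective {a : Tuple r (EuclideanSpace ℝ (Fin n₁))}
    (ha : LinearIndependent ℝ fun i => a i) :
    Function.Injective (sumOuterL r n₁ n₂ n₃ a) := by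
  rw [injective_iff_map_eq_zero]
  intro N hN
  ext i q
  have h : ∑ j, N j q • a j = 0 := by
    ext k
    have := congrArg (fun T : Tensor n₁ n₂ n₃ => T (k, q)) hN
    simpa [mul_comm] using this
  exact Fintype.linearIndependent_iff.1 ha _ h i

/-- Inner products of outer products factor, so the cross terms carry the factor `⟨aᵢ, aⱼ⟩ = 0` and
Pythagoras applies. -/
theorem norm_sumOuterL_of_orthonormal {a : Tuple r (EuclideanSpace ℝ (Fin n₁))}
    (ha : Orthonormal ℝ fun i => a i) (N : Tuple r (EuclideanSpace ℝ (Fin n₂ × Fin n₃))) :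
    ‖sumOuterL r n₁ n₂ n₃ a N‖ = ‖N‖ := by
  classical
  rw [← sq_eq_sq₀ (norm_nonneg _) (norm_nonneg _), ← real_inner_self_eq_norm_sq,
    PiLp.norm_sq_eq_of_L2, sumOuterL_apply]
  simp only [sum_inner, inner_sum, inner_outerL]
  refine Finset.sum_congr rfl fun i _ => ?_
  simp [orthonormal_iff_ite.1 ha]

theorem sum_norm_mul_norm_le {E F : Type} [NormedAddCommGroup E] [NormedAddCommGroup F]
    (x : Tuple r E) (y : Tuple r F) : ∑ i, ‖x i‖ * ‖y i‖ ≤ ‖x‖ * ‖y‖ := by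
  rw [PiLp.norm_eq_of_L2, PiLp.norm_eq_of_L2]
  exact Real.sum_mul_le_sqrt_mul_sqrt _ _ _

theorem norm_sumOuterL_le (a : Tuple r (EuclideanSpace ℝ (Fin n₁)))
    (N : Tuple r (EuclideanSpace ℝ (Fin n₂ × Fin n₃))) :
    ‖sumOuterL r n₁ n₂ n₃ a N‖ ≤ ‖a‖ * ‖N‖ := by
  rw [sumOuterL_apply]
  refine (norm_sum_le _ _).trans ?_
  simp only [norm_outerL]
  exact sum_norm_mul_norm_le a N

/-- The map for `a'` is an isometry, and by Cauchy–Schwarz replacing `a'` by `a` changes it by at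
most `ν` in operator norm. -/
theorem norm_le_of_near_orthonormal {ν : ℝ} {a a' : Tuple r (EuclideanSpace ℝ (Fin n₁))}
    (ha' : Orthonormal ℝ fun i => a' i) (h : ‖a - a'‖ ≤ ν)
    (N : Tuple r (EuclideanSpace ℝ (Fin n₂ × Fin n₃))) :
    (1 - ν) * ‖N‖ ≤ ‖sumOuterL r n₁ n₂ n₃ a N‖ := by
  have h1 : sumOuterL r n₁ n₂ n₃ a' N =
      sumOuterL r n₁ n₂ n₃ a N - sumOuterL r n₁ n₂ n₃ (a - a') N := by
    rw [map_sub, sub_apply, sub_sub_cancel]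
  have h2 := norm_sub_le (sumOuterL r n₁ n₂ n₃ a N) (sumOuterL r n₁ n₂ n₃ (a - a') N)
  rw [← h1, norm_sumOuterL_of_orthonormal ha'] at h2
  have h3 := (norm_sumOuterL_le (a - a') N).trans
    (mul_le_mul_of_nonneg_right h (norm_nonneg N))
  linarith

theorem norm_tuple_le {E : Type} [NormedAddCommGroup E] {F : Type} [NormedAddCommGroup F]
    {x : Tuple r E} {y : Tuple r F} {K : ℝ} (hK : 0 ≤ K) (h : ∀ i, ‖x i‖ ≤ K * ‖y i‖) :
    ‖x‖ ≤ K * ‖y‖ := by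
  rw [← sq_le_sq₀ (norm_nonneg _) (by positivity), mul_pow, PiLp.norm_sq_eq_of_L2,
    PiLp.norm_sq_eq_of_L2, Finset.mul_sum]
  refine Finset.sum_le_sum fun i _ => ?_
  rw [← mul_pow]
  exact pow_le_pow_left₀ (norm_nonneg _) (h i) 2

/-- The tuple `(aᵢ ⊗ Nᵢ)ᵢ`, bilinear in `a` and `N`. -/
def tupleOuterL (r n₁ n₂ n₃ : ℕ) : Tuple r (EuclideanSpace ℝ (Fin n₁)) →L[ℝ]
    Tuple r (EuclideanSpace ℝ (Fin n₂ × Fin n₃)) →L[ℝ] Tuple r (Tensor n₁ n₂ n₃) :=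
  LinearMap.mkContinuous₂
    (LinearMap.mk₂ ℝ (fun (a : Tuple r (EuclideanSpace ℝ (Fin n₁)))
      (N : Tuple r (EuclideanSpace ℝ (Fin n₂ × Fin n₃))) =>
        (WithLp.toLp 2 fun i => outerL n₁ n₂ n₃ (a i) (N i) : Tuple r (Tensor n₁ n₂ n₃)))
      (fun a b N => by ext i p; simp)
      (fun c a N => by ext i p; simp)
      (fun a M N => by ext i p; simp)
      (fun c a N => by ext i p; simp)) 1 fun a N => by
    rw [one_mul]
    refine norm_tuple_le (norm_nonneg a) fun i => ?_
    change ‖outerL n₁ n₂ n₃ (a i) (N i)‖ ≤ _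
    rw [norm_outerL]
    exact mul_le_mul_of_nonneg_right (PiLp.norm_apply_le a i) (norm_nonneg _)

@[simp]
theorem tupleOuterL_apply (a : Tuple r (EuclideanSpace ℝ (Fin n₁)))
    (N : Tuple r (EuclideanSpace ℝ (Fin n₂ × Fin n₃))) (i : Fin r) :
    tupleOuterL r n₁ n₂ n₃ a N i = outerL n₁ n₂ n₃ (a i) (N i) := rfl

theorem addMap_tupleOuterL (a : Tuple r (EuclideanSpace ℝ (Fin n₁)))
    (N : Tuple r (EuclideanSpace ℝ (Fin n₂ × Fin n₃))) :
    addMap (tupleOuterL r n₁ n₂ n₃ a N) = sumOuterL r n₁ n₂ n₃ a N := by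
  simp [addMap]

/-- The size of an infinitesimal variation of the decomposition is bounded by those of the
variations of the first factors and of the sum. -/
theorem norm_variation_le {ν : ℝ} (hν : ν ≤ 1 / 2) (hν0 : 0 ≤ ν) (hr : 1 ≤ r)
    {a a' : Tuple r (EuclideanSpace ℝ (Fin n₁))}
    (ha' : Orthonormal ℝ fun i => a' i) (h : ‖a - a'‖ ≤ ν) (ha : ∀ i, ‖a i‖ = 1)
    {N : Tuple r (EuclideanSpace ℝ (Fin n₂ × Fin n₃))} (hN : ∀ i, ‖N i‖ ≤ 1 + ν)
    (u : Tuple r (EuclideanSpace ℝ (Fin n₁)))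
    (K : Tuple r (EuclideanSpace ℝ (Fin n₂ × Fin n₃))) :
    ‖tupleOuterL r n₁ n₂ n₃ a K + tupleOuterL r n₁ n₂ n₃ u N‖ ≤
      10 * r * (‖u‖ + ‖addMap (tupleOuterL r n₁ n₂ n₃ a K + tupleOuterL r n₁ n₂ n₃ u N)‖) := by
  have hr' : (1 : ℝ) ≤ r := by exact_mod_cast hr
  have e : addMap (tupleOuterL r n₁ n₂ n₃ a K + tupleOuterL r n₁ n₂ n₃ u N) =
      sumOuterL r n₁ n₂ n₃ a K + sumOuterL r n₁ n₂ n₃ u N := by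
    rw [← addMap_tupleOuterL, ← addMap_tupleOuterL]
    simp [addMap, Finset.sum_add_distrib]
  rw [e]
  set v := sumOuterL r n₁ n₂ n₃ a K + sumOuterL r n₁ n₂ n₃ u N with hv
  have h1 : ‖tupleOuterL r n₁ n₂ n₃ a K‖ ≤ 1 * ‖K‖ :=
    norm_tuple_le zero_le_one fun i => by simp [norm_outerL, ha i]
  have h2 : ‖tupleOuterL r n₁ n₂ n₃ u N‖ ≤ (1 + ν) * ‖u‖ :=
    norm_tuple_le (by linarith) fun i => by
      rw [tupleOuterL_apply, norm_outerL, mul_comm]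
      exact mul_le_mul_of_nonneg_right (hN i) (norm_nonneg _)
  have h3 := norm_le_of_near_orthonormal ha' h K
  -- The factor `r` comes from the crude bound `‖u i‖ ≤ ‖u‖` in each summand; Cauchy–Schwarz would
  -- give `√r`.
  have h4 : ‖sumOuterL r n₁ n₂ n₃ u N‖ ≤ r * ((1 + ν) * ‖u‖) := by
    rw [sumOuterL_apply]
    refine (norm_sum_le_of_le _ (f := fun i => outerL n₁ n₂ n₃ (u i) (N i))
      (n := fun _ => (1 + ν) * ‖u‖) fun i _ => ?_).trans (by simp)
    rw [norm_outerL, mul_comm]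
    exact mul_le_mul (hN i) (PiLp.norm_apply_le u i) (norm_nonneg _) (by linarith)
  have h5 : ‖sumOuterL r n₁ n₂ n₃ a K‖ ≤ ‖v‖ + ‖sumOuterL r n₁ n₂ n₃ u N‖ := by
    have : sumOuterL r n₁ n₂ n₃ a K = v - sumOuterL r n₁ n₂ n₃ u N := by rw [hv]; abel
    rw [this]
    exact norm_sub_le _ _
  have h6 := norm_add_le (tupleOuterL r n₁ n₂ n₃ a K) (tupleOuterL r n₁ n₂ n₃ u N)
  -- This is where `ν ≤ 1 / 2` matters most: the lower bound `1 - ν` is at least one half.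
  have hK : ‖K‖ ≤ 2 * ((1 - ν) * ‖K‖) := by nlinarith [norm_nonneg K]
  have hu : (1 + ν) * ‖u‖ ≤ 3 / 2 * ‖u‖ :=
    mul_le_mul_of_nonneg_right (by linarith) (norm_nonneg _)
  have hru : ‖u‖ ≤ r * ‖u‖ := le_mul_of_one_le_left (norm_nonneg _) hr'
  have hrv : ‖v‖ ≤ r * ‖v‖ := le_mul_of_one_le_left (norm_nonneg _) hr'
  have h7 : r * ((1 + ν) * ‖u‖) ≤ r * (3 / 2 * ‖u‖) :=
    mul_le_mul_of_nonneg_left hu (by linarith)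
  -- The total is at most `3/2 ‖u‖ + 2 (‖v‖ + 3/2 r ‖u‖)`, well below `10 r (‖u‖ + ‖v‖)`.
  nlinarith [norm_nonneg u, norm_nonneg v]

/-! ### Permutations of decompositions -/

/-- Reordering of tuples, as a linear isometry. -/
def permTuple {E : Type} [NormedAddCommGroup E] [NormedSpace ℝ E] (σ : Equiv.Perm (Fin r)) :
    Tuple r E ≃ₗᵢ[ℝ] Tuple r E :=
  LinearIsometryEquiv.piLpCongrLeft 2 ℝ E σ.symm

@[simp]
theorem permTuple_apply {E : Type} [NormedAddCommGroup E] [NormedSpace ℝ E]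
    (σ : Equiv.Perm (Fin r)) (x : Tuple r E) (i : Fin r) : permTuple σ x i = x (σ i) := by
  simp [permTuple, LinearIsometryEquiv.piLpCongrLeft_apply, Equiv.piCongrLeft'_apply]

@[simp]
theorem addMap_permTuple (σ : Equiv.Perm (Fin r)) (x : Tuple r (Tensor n₁ n₂ n₃)) :
    addMap (permTuple σ x) = addMap x := by
  simp only [addMap, permTuple_apply]
  exact Equiv.sum_comp σ fun i => x i

theorem permTuple_mem_segreTuples {σ : Equiv.Perm (Fin r)} {x : Tuple r (Tensor n₁ n₂ n₃)} :
    permTuple σ x ∈ segreTuples r n₁ n₂ n₃ ↔ x ∈ segreTuples r n₁ n₂ n₃ := by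
  simp only [segreTuples, mem_ofPred_eq, permTuple_apply]
  exact σ.forall_congr_right (q := fun i => x i ∈ segre n₁ n₂ n₃)

/-- The addition map is invariant under reordering, so a local inverse can be transported by the
isometry `permTuple σ`. -/
theorem IsLocalInverse.permTuple {x : Tuple r (Tensor n₁ n₂ n₃)} {D : Set (Tensor n₁ n₂ n₃)}
    {ψ : Tensor n₁ n₂ n₃ → Tuple r (Tensor n₁ n₂ n₃)} (h : IsLocalInverse x D ψ)
    (σ : Equiv.Perm (Fin r)) :
    IsLocalInverse (permTuple σ x) D fun T => PBA.permTuple σ (ψ T) := by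
  obtain ⟨U, hU, hx, hD, hψ, hc⟩ := h
  let e : Tuple r (Tensor n₁ n₂ n₃) ≃ₗᵢ[ℝ] Tuple r (Tensor n₁ n₂ n₃) := PBA.permTuple σ
  have key : ∀ y, e.symm y ∈ segreTuples r n₁ n₂ n₃ ↔ y ∈ segreTuples r n₁ n₂ n₃ := fun y => by
    rw [← permTuple_mem_segreTuples (σ := σ)]
    exact iff_of_eq (congrArg (· ∈ _) (e.apply_symm_apply y))
  have hadd : ∀ y, addMap (e.symm y) = addMap y := fun y => by
    rw [← addMap_permTuple σ]
    exact congrArg addMap (e.apply_symm_apply y)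
  refine ⟨e.symm ⁻¹' U, hU.preimage e.symm.continuous, ?_, ?_, ?_, ?_⟩
  · change e.symm (e x) ∈ U
    rwa [e.symm_apply_apply]
  · rw [hD]
    ext T
    constructor
    · rintro ⟨y, ⟨hyU, hy⟩, rfl⟩
      refine ⟨e y, ⟨?_, permTuple_mem_segreTuples.2 hy⟩, addMap_permTuple σ y⟩
      change e.symm (e y) ∈ U
      rwa [e.symm_apply_apply]
    · rintro ⟨y, ⟨hyU, hy⟩, rfl⟩
      exact ⟨e.symm y, ⟨hyU, (key y).2 hy⟩, hadd y⟩
  · rintro y ⟨hyU, hy⟩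
    have := hψ (e.symm y) ⟨hyU, (key y).2 hy⟩
    rw [hadd] at this
    change e (ψ (addMap y)) = y
    rw [this, e.apply_symm_apply]
  · exact e.continuous.comp_continuousOn hc

theorem cpdCond_permTuple_le (σ : Equiv.Perm (Fin r)) (x : Tuple r (Tensor n₁ n₂ n₃)) :
    cpdCond (permTuple σ x) ≤ cpdCond x := by
  refine le_iInf fun D => le_iInf fun ψ => le_iInf fun h => ?_
  refine iInf_le_of_le D (iInf_le_of_le _ (iInf_le_of_le (h.permTuple σ) (le_of_eq ?_)))
  rw [addMap_permTuple]
  congr 1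
  ext T
  rw [← map_sub, LinearIsometryEquiv.enorm_map]

theorem IsGLP.comp_perm {E : Type} [AddCommGroup E] [Module ℝ E] {p : Fin r → E}
    (hp : IsGLP p) (σ : Equiv.Perm (Fin r)) : IsGLP fun i => p (σ i) := by
  intro s hs
  have h := hp (s.map σ.toEmbedding) (by rwa [Finset.card_map])
  exact h.comp (fun i : s => ⟨σ i, Finset.mem_map_of_mem _ i.2⟩) fun i j hij =>
    Subtype.ext (σ.injective (congrArg Subtype.val hij))

theorem IsSGLP.permTuple {x : Tuple r (Tensor n₁ n₂ n₃)} (h : IsSGLP x)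
    (σ : Equiv.Perm (Fin r)) : IsSGLP (permTuple σ x) := by
  obtain ⟨a, b, c, hx, h1, h2, h3, h4, h5, h6, h7⟩ := h
  exact ⟨fun i => a (σ i), fun i => b (σ i), fun i => c (σ i),
    fun i => by rw [permTuple_apply, hx], h1.comp_perm σ, h2.comp_perm σ, h3.comp_perm σ,
    h4.comp_perm σ, h5.comp_perm σ, h6.comp_perm σ, h7.comp_perm σ⟩

/-- Needed because a lift of `theta` may list the factors in any order. -/
theorem permTuple_mem_niceTuples [NeZero n₁] [NeZero n₂] [NeZero n₃]
    {x : Tuple r (Tensor n₁ n₂ n₃)} (hx : x ∈ niceTuples r n₁ n₂ n₃) (σ : Equiv.Perm (Fin r)) :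
    permTuple σ x ∈ niceTuples r n₁ n₂ n₃ := by
  obtain ⟨h1, h2, h3, h4, h5, h6⟩ := hx
  refine ⟨permTuple_mem_segreTuples.2 h1, ?_, ?_, (cpdCond_permTuple_le σ x).trans_lt h4,
    h5.permTuple σ, fun i => by rw [permTuple_apply]; exact h6 _⟩
  · rwa [addMap_permTuple]
  · rwa [addMap_permTuple]

/-! ### Decompositions of nice tensors -/

/-- The summands of a length-`r` decomposition of a tensor of rank `r` do not vanish. -/
theorem IsIdentifiable.mem_segreTuples (hr : 1 ≤ r) {T : Tensor n₁ n₂ n₃}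
    (hT : IsIdentifiable r T) {a : Fin r → EuclideanSpace ℝ (Fin n₁)}
    {b : Fin r → EuclideanSpace ℝ (Fin n₂)} {c : Fin r → EuclideanSpace ℝ (Fin n₃)}
    (h : T = ∑ i, outer₃ (a i) (b i) (c i)) :
    (WithLp.toLp 2 fun i => outer₃ (a i) (b i) (c i) : Tuple r (Tensor n₁ n₂ n₃)) ∈
      segreTuples r n₁ n₂ n₃ := by
  intro i
  refine ⟨fun h0 => ?_, a i, b i, c i, rfl⟩
  -- Omitting a zero summand would leave a decomposition of length `r - 1`, against the rank being
  -- `r`.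
  obtain ⟨s, rfl⟩ : ∃ s, r = s + 1 := ⟨r - 1, by omega⟩
  refine hT.1 s s.lt_succ_self ⟨fun j => a (i.succAbove j), fun j => b (i.succAbove j),
    fun j => c (i.succAbove j), ?_⟩
  rw [h, Fin.sum_univ_succAbove _ i]
  change outer₃ (a i) (b i) (c i) = 0 at h0
  rw [h0, zero_add]

/-- A lift of `theta r T` to an ordered tuple gives a nice decomposition of `T` with these first
factors. -/
theorem exists_niceTuple_of_theta_eq [NeZero n₁] [NeZero n₂] [NeZero n₃] {T : Tensor n₁ n₂ n₃}
    (hT : T ∈ niceTensors r n₁ n₂ n₃) {a : Tuple r (EuclideanSpace ℝ (Fin n₁))}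
    (h : unord a = theta r T) :
    ∃ N : Tuple r (EuclideanSpace ℝ (Fin n₂ × Fin n₃)),
      tupleOuterL r n₁ n₂ n₃ a N ∈ niceTuples r n₁ n₂ n₃ ∧ sumOuterL r n₁ n₂ n₃ a N = T := by
  obtain ⟨x, hx, rfl⟩ := hT
  obtain ⟨a₀, ha₀, hax⟩ := exists_factorTuples hx
  rw [theta_addMap ha₀ hx hax] at h
  obtain ⟨σ, hσ⟩ := (unord_eq_unord_iff _ _).1 h
  choose b c hbc using hax
  refine ⟨WithLp.toLp 2 fun i => outer₂ (b (σ i)) (c (σ i)), ?_⟩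
  have e : tupleOuterL r n₁ n₂ n₃ a (WithLp.toLp 2 fun i => outer₂ (b (σ i)) (c (σ i))) =
      permTuple σ x := by
    ext1 i
    rw [tupleOuterL_apply, permTuple_apply, hbc, outer₃_eq_outerL, hσ]
  rw [← addMap_tupleOuterL, e]
  exact ⟨permTuple_mem_niceTuples hx σ, addMap_permTuple σ x⟩

theorem linearIndependent_of_mem_factorTuples {n : ℕ} [NeZero n] (hrn : r ≤ n)
    {a : Tuple r (EuclideanSpace ℝ (Fin n))} (ha : a ∈ factorTuples r n) :
    LinearIndependent ℝ fun i => a i := by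
  rw [linearIndependent_iff_card_eq_finrank_span, Set.finrank, ha.2, Fintype.card_fin,
    min_eq_left hrn]

/-- Two decompositions with unit first factors of an identifiable tensor agree: near-orthonormality
and norm bounds carry over from one to the other. -/
theorem near_orthonormal_of_decomposition [NeZero n₁] [NeZero n₂] [NeZero n₃] (hr : 1 ≤ r)
    {ν : ℝ} {a a' : Tuple r (EuclideanSpace ℝ (Fin n₁))} {b : Fin r → EuclideanSpace ℝ (Fin n₂)}
    {c : Fin r → EuclideanSpace ℝ (Fin n₃)} (ha : ∀ i, ‖a i‖ = 1)
    (hbc : ∀ i, ‖outer₂ (b i) (c i)‖ < 1 + ν) (ha' : Orthonormal ℝ fun i => a' i)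
    (hν : ‖a - a'‖ ≤ ν) {p : Tuple r (EuclideanSpace ℝ (Fin n₁))}
    {N : Tuple r (EuclideanSpace ℝ (Fin n₂ × Fin n₃))} (hp : ∀ i, ‖p i‖ = 1)
    (hnice : tupleOuterL r n₁ n₂ n₃ p N ∈ niceTuples r n₁ n₂ n₃)
    (h : sumOuterL r n₁ n₂ n₃ p N = ∑ i, outer₃ (a i) (b i) (c i)) :
    (∀ i, ‖N i‖ ≤ 1 + ν) ∧ ∃ p' : Tuple r (EuclideanSpace ℝ (Fin n₁)),
      Orthonormal ℝ (fun i => p' i) ∧ ‖p - p'‖ ≤ ν := by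
  classical
  rw [← addMap_tupleOuterL] at h
  -- The given decomposition is not assumed nice. Its summands are nonzero because the rank is `r`,
  -- so uniqueness identifies it with the nice one up to order.
  have hseg := hnice.2.2.1.mem_segreTuples hr h
  obtain ⟨σ, hσ⟩ := (unord_eq_unord_iff _ _).1
    (unord_eq_of_addMap_eq hnice hseg (by rw [h]; rfl)).symm
  have hσ' : ∀ i, outerL n₁ n₂ n₃ (p i) (N i) =
      outerL n₁ n₂ n₃ (a (σ i)) (outer₂ (b (σ i)) (c (σ i))) := fun i => by
    rw [← outer₃_eq_outerL]
    exact hσ i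
  constructor
  · intro i
    have := congrArg norm (hσ' i)
    rw [norm_outerL, norm_outerL, hp, ha, one_mul, one_mul] at this
    rw [this]
    exact (hbc _).le
  · have hs : ∀ i, ∃ s : ℝ, s * s = 1 ∧ p i = s • a (σ i) := fun i => by
      refine eq_smul_of_outerL_eq (hp i) (ha (σ i)) (fun h0 => (hnice.1 i).1 ?_) (hσ' i)
      rw [tupleOuterL_apply, h0, map_zero]
    choose s hs1 hs2 using hs
    have hs3 : ∀ i, ‖s i‖ = 1 := fun i => by
      rw [← sq_eq_sq₀ (norm_nonneg _) zero_le_one, Real.norm_eq_abs, sq_abs, sq, hs1, one_pow]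
    -- The orthonormal tuple undergoes the same permutation and sign changes that turn `a` into `p`,
    -- so distances are kept.
    refine ⟨WithLp.toLp 2 fun i => s i • a' (σ i), ?_, ?_⟩
    · rw [orthonormal_iff_ite]
      intro i j
      have := orthonormal_iff_ite.1 ha' (σ i) (σ j)
      simp only [inner_smul_left, inner_smul_right, this, σ.injective.eq_iff]
      split_ifs with hij
      · subst hij
        simpa using hs1 i
      · simp
    · refine le_trans ?_ hν
      rw [← (permTuple σ : Tuple r (EuclideanSpace ℝ (Fin n₁)) ≃ₗᵢ[ℝ] _).norm_map (a - a')]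
      refine (norm_tuple_le zero_le_one fun i => ?_).trans_eq (one_mul _)
      simp [hs2 i, ← smul_sub, norm_smul, hs3]

/-! ### Lifting curves of nice tensors -/

theorem exists_continuousLinearMap_leftInverse {F G : Type} [NormedAddCommGroup F]
    [NormedSpace ℝ F] [FiniteDimensional ℝ F] [NormedAddCommGroup G] [NormedSpace ℝ G]
    [FiniteDimensional ℝ G] {L : F →L[ℝ] G} (hL : Function.Injective L) :
    ∃ R : G →L[ℝ] F, ∀ x, R (L x) = x := by
  obtain ⟨R, hR⟩ := LinearMap.exists_leftInverse_of_injective L.toLinearMap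
    (LinearMap.ker_eq_bot.2 hL)
  exact ⟨LinearMap.toContinuousLinearMap R, LinearMap.congr_fun hR⟩

/-- If `x` and `g` are smooth curves and `L (x 0)` is injective, then the solution `K` of
`L (x t) K = g t` depends smoothly on `t` near `0`. -/
theorem exists_contDiffOn_solution {E F G : Type} [NormedAddCommGroup E] [NormedSpace ℝ E]
    [NormedAddCommGroup F] [NormedSpace ℝ F] [FiniteDimensional ℝ F] [NormedAddCommGroup G]
    [NormedSpace ℝ G] [FiniteDimensional ℝ G] (L : E →L[ℝ] F →L[ℝ] G) {x : ℝ → E} {g : ℝ → G}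
    {ε : ℝ} (hε : 0 < ε) (hx : ContDiffOn ℝ ∞ x (Ioo (-ε) ε))
    (hg : ContDiffOn ℝ ∞ g (Ioo (-ε) ε)) (hL : Function.Injective (L (x 0))) :
    ∃ δ > 0, δ ≤ ε ∧ ∃ N : ℝ → F, ContDiffOn ℝ ∞ N (Ioo (-δ) δ) ∧
      ∀ t ∈ Ioo (-δ) δ, ∀ K, L (x t) K = g t → K = N t := by
  have : CompleteSpace F := FiniteDimensional.complete ℝ F
  obtain ⟨R, hR⟩ := exists_continuousLinearMap_leftInverse hL
  -- With a fixed left inverse `R` of `L (x 0)`, the equation implies the square system `P t K = R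
  -- (g t)`, where `P 0 = 1` and so `P t` is invertible for small `t`. Solvability is not claimed:
  -- `N t` is the only candidate.
  let P : ℝ → (F →L[ℝ] F) := fun t => R.comp (L (x t))
  have hP : ContDiffOn ℝ ∞ P (Ioo (-ε) ε) :=
    contDiffOn_const.clm_comp (L.contDiff.comp_contDiffOn hx)
  have hP0 : P 0 = 1 := by
    ext1 K
    exact hR K
  have h0 : (0 : ℝ) ∈ Ioo (-ε) ε := ⟨by linarith, hε⟩
  have hunit : ∀ᶠ t in 𝓝 (0 : ℝ), IsUnit (P t) :=
    (hP.continuousOn.continuousAt (isOpen_Ioo.mem_nhds h0)).eventually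
      (Units.isOpen.mem_nhds (by rw [hP0]; exact isUnit_one))
  obtain ⟨δ', hδ', hδ⟩ := Metric.eventually_nhds_iff.1 hunit
  have hsub : ∀ t ∈ Ioo (-min δ' ε) (min δ' ε), t ∈ Ioo (-ε) ε ∧ IsUnit (P t) := by
    intro t ht
    have ht' := abs_lt.2 ht
    refine ⟨abs_lt.1 (ht'.trans_le (min_le_right _ _)), hδ ?_⟩
    rw [Real.dist_eq, sub_zero]
    exact ht'.trans_le (min_le_left _ _)
  refine ⟨min δ' ε, lt_min hδ' hε, min_le_right _ _, fun t => Ring.inverse (P t) (R (g t)), ?_, ?_⟩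
  · intro t ht
    obtain ⟨h1, u, hu⟩ := hsub t ht
    refine ContDiffWithinAt.clm_apply ?_ ?_
    · refine ContDiffAt.comp_contDiffWithinAt (g := Ring.inverse) t ?_ ((hP t h1).mono fun s hs => (hsub s hs).1)
      rw [← hu]
      exact contDiffAt_ringInverse ℝ u
    · exact R.contDiff.contDiffAt.comp_contDiffWithinAt t
        ((hg t h1).mono fun s hs => (hsub s hs).1)
  · intro t ht K hK
    have h1 := Ring.inverse_mul_cancel _ (hsub t ht).2
    beta_reduce
    rw [← hK]
    exact (DFunLike.congr_fun h1 K).symm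

/-- A continuous bilinear map takes smooth curves to a smooth curve; its velocity is given by
the product rule. -/
theorem contDiffOn_and_hasDerivAt_bilinear {E F G : Type} [NormedAddCommGroup E]
    [NormedSpace ℝ E] [NormedAddCommGroup F] [NormedSpace ℝ F] [NormedAddCommGroup G]
    [NormedSpace ℝ G] (L : E →L[ℝ] F →L[ℝ] G) {x : ℝ → E} {x' : E} {N : ℝ → F} {δ : ℝ}
    (hδ : 0 < δ) (hx : ContDiffOn ℝ ∞ x (Ioo (-δ) δ)) (hx' : HasDerivAt x x' 0)
    (hN : ContDiffOn ℝ ∞ N (Ioo (-δ) δ)) :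
    ContDiffOn ℝ ∞ (fun t => L (x t) (N t)) (Ioo (-δ) δ) ∧
      HasDerivAt (fun t => L (x t) (N t)) (L (x 0) (deriv N 0) + L x' (N 0)) 0 := by
  have hd : HasDerivAt N (deriv N 0) 0 :=
    ((hN.contDiffAt (isOpen_Ioo.mem_nhds ⟨by linarith, hδ⟩)).differentiableAt
      (by simp)).hasDerivAt
  exact ⟨(L.contDiff.comp_contDiffOn hx).clm_apply hN, L.hasDerivAt_of_bilinear (fun _ => hx') fun _ => hd⟩

/-- A smooth lift of the curve of first factors yields a smooth lift of the curve of
decompositions. -/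
theorem unordSpeed_tdm_le [NeZero n₁] [NeZero n₂] [NeZero n₃] (hr : 1 ≤ r) (hrn : r ≤ n₁)
    {ν : ℝ} (hν : ν ≤ 1 / 2) (hν0 : 0 ≤ ν) {a a' : Tuple r (EuclideanSpace ℝ (Fin n₁))}
    {b : Fin r → EuclideanSpace ℝ (Fin n₂)}
    {c : Fin r → EuclideanSpace ℝ (Fin n₃)} (ha : ∀ i, ‖a i‖ = 1)
    (hbc : ∀ i, ‖outer₂ (b i) (c i)‖ < 1 + ν) (ha' : Orthonormal ℝ fun i => a' i)
    (haν : ‖a - a'‖ ≤ ν) {v : Tensor n₁ n₂ n₃} {γ : ℝ → Tensor n₁ n₂ n₃}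
    (hγ : IsCurve (niceTensors r n₁ n₂ n₃) (∑ i, outer₃ (a i) (b i) (c i)) v γ)
    {y w : Tuple r (EuclideanSpace ℝ (Fin n₁))} {p : ℝ → Tuple r (EuclideanSpace ℝ (Fin n₁))}
    (hp : IsCurve (factorTuples r n₁) y w p) (hlift : ∀ᶠ t in 𝓝 0, unord (p t) = theta r (γ t)) :
    unordSpeed (niceTuples r n₁ n₂ n₃) (fun t => tdm r (γ t)) ≤ 10 * r * (‖w‖ₑ + ‖v‖ₑ) := by
  obtain ⟨hγ0, hγv, ε₁, hε₁, hγs, hγm⟩ := hγ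
  obtain ⟨-, hpw, ε₂, hε₂, hps, hpm⟩ := hp
  obtain ⟨ε₃, hε₃, hlift⟩ := Metric.eventually_nhds_iff.1 hlift
  have hε : 0 < min ε₁ (min ε₂ ε₃) := lt_min hε₁ (lt_min hε₂ hε₃)
  have mono : ∀ {α β : ℝ}, α ≤ β → Ioo (-α) α ⊆ Ioo (-β) β := fun h =>
    Ioo_subset_Ioo (neg_le_neg h) h
  have m1 := mono (min_le_left ε₁ (min ε₂ ε₃))
  have m2 := mono ((min_le_right ε₁ (min ε₂ ε₃)).trans (min_le_left ε₂ ε₃))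
  have m3 := mono ((min_le_right ε₁ (min ε₂ ε₃)).trans (min_le_right ε₂ ε₃))
  have p0 : p 0 ∈ factorTuples r n₁ := hpm 0 ⟨by linarith, hε₂⟩
  obtain ⟨δ, hδ, hδε, N, hNs, hN⟩ := exists_contDiffOn_solution (sumOuterL r n₁ n₂ n₃) hε
    (hps.mono m2) (hγs.mono m1)
    (sumOuterL_injective (linearIndependent_of_mem_factorTuples hrn p0))
  -- At each time the lift of `theta` provides some nice solution of the linear system; uniqueness
  -- makes it the smooth `N t`.
  have key : ∀ t ∈ Ioo (-δ) δ, tupleOuterL r n₁ n₂ n₃ (p t) (N t) ∈ niceTuples r n₁ n₂ n₃ ∧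
      sumOuterL r n₁ n₂ n₃ (p t) (N t) = γ t := by
    intro t ht
    have ht' := mono hδε ht
    obtain ⟨K, hK1, hK2⟩ := exists_niceTuple_of_theta_eq (hγm t (m1 ht')) (a := p t) (hlift (by
      rw [Real.dist_eq, sub_zero]
      exact abs_lt.2 (m3 ht')))
    rw [← hN t ht K hK2]
    exact ⟨hK1, hK2⟩
  have h0 : (0 : ℝ) ∈ Ioo (-δ) δ := ⟨by linarith, hδ⟩
  have hnhds : Ioo (-δ) δ ∈ 𝓝 (0 : ℝ) := isOpen_Ioo.mem_nhds h0
  have hpδ := hps.mono ((mono hδε).trans m2)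
  obtain ⟨hs, hd⟩ := contDiffOn_and_hasDerivAt_bilinear (tupleOuterL r n₁ n₂ n₃) hδ hpδ hpw hNs
  have hsum : addMap (tupleOuterL r n₁ n₂ n₃ (p 0) (deriv N 0) +
      tupleOuterL r n₁ n₂ n₃ w (N 0)) = v := by
    have h1 := (contDiffOn_and_hasDerivAt_bilinear (sumOuterL r n₁ n₂ n₃) hδ hpδ hpw hNs).2
    have h2 : (fun t => sumOuterL r n₁ n₂ n₃ (p t) (N t)) =ᶠ[𝓝 0] γ :=
      Filter.eventually_of_mem hnhds fun t ht => (key t ht).2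
    have h3 := (hγv.congr_of_eventuallyEq h2).unique h1
    rw [h3, ← addMap_tupleOuterL, ← addMap_tupleOuterL]
    simp [addMap, Finset.sum_add_distrib]
  -- The velocity bound is applied to the lifted factors `p 0`, which agree with `a` only up to
  -- order and signs.
  obtain ⟨hN0, p', hp', hpp'⟩ := near_orthonormal_of_decomposition hr ha hbc ha' haν
    (fun i => (p0.1 i).1) (key 0 h0).1 ((key 0 h0).2.trans hγ0)
  have hbound := norm_variation_le hν hν0 hr hp' hpp' (fun i => (p0.1 i).1) hN0 w (deriv N 0)
  rw [hsum] at hbound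
  refine iInf_le_of_le _ (iInf_le_of_le ⟨_, fun t => tupleOuterL r n₁ n₂ n₃ (p t) (N t),
    ⟨rfl, hd, δ, hδ, hs, fun t ht => (key t ht).1⟩, ?_⟩ ?_)
  · filter_upwards [hnhds] with t ht
    rw [← tdm_addMap (key t ht).1, addMap_tupleOuterL, (key t ht).2]
  · have h := ENNReal.ofReal_le_ofReal hbound
    rw [ofReal_norm, ENNReal.ofReal_mul (by positivity), ENNReal.ofReal_add (norm_nonneg _)
      (norm_nonneg _), ofReal_norm, ofReal_norm, ENNReal.ofReal_mul (by norm_num),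
      ENNReal.ofReal_natCast, ENNReal.ofReal_ofNat] at h
    exact h

end PBA

end

/-- Condition numbers are in `[0, ∞]`; the (truncated) subtraction of `1` on the left makes no
difference, as the right-hand side is nonnegative. -/
theorem lemma6p2 :
    ∃ ν₀ : ℝ, 0 < ν₀ ∧ ∀ ν : ℝ, 0 < ν → ν ≤ ν₀ →
      ∀ (r n₁ n₂ : ℕ) [NeZero n₁] [NeZero n₂], 1 ≤ r →
      ∀ (a : PBA.Tuple r (EuclideanSpace ℝ (Fin n₁)))
        (b : Fin r → EuclideanSpace ℝ (Fin n₂)) (z : Fin r → EuclideanSpace ℝ (Fin 2))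
        (B : PBA.Tensor n₁ n₂ 2),
        B = ∑ i, PBA.outer₃ (a i) (b i) (z i) →
        B ∈ PBA.niceTensors r n₁ n₂ 2 →
        (∀ i, ‖a i‖ = 1) →
        (∀ i, ‖PBA.outer₂ (b i) (z i)‖ < 1 + ν) →
        (∃ a' : PBA.Tuple r (EuclideanSpace ℝ (Fin n₁)),
          Orthonormal ℝ (fun i => a' i) ∧ ‖a - a'‖ ≤ ν) →
        PBA.condTdm r B / (10 * (r : ENNReal)) - 1 ≤ PBA.condTheta r B := by
  refine ⟨1 / 2, by norm_num, ?_⟩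
  rintro ν hν0 hν r n₁ n₂ _ _ hr a b z B rfl - ha hbz ⟨a', ha', haν⟩
  -- There is room for `r` orthonormal vectors, so full rank of a factor matrix means independent
  -- columns.
  have hrn : r ≤ n₁ := by
    simpa using ha'.linearIndependent.fintype_card_le_finrank
  have hr0 : (10 * (r : ENNReal)) ≠ 0 := mul_ne_zero (by norm_num) (by
    exact_mod_cast (Nat.one_le_iff_ne_zero.1 hr))
  have hrt : (10 * (r : ENNReal)) ≠ ⊤ := ENNReal.mul_ne_top (by norm_num) (by simp)
  rw [tsub_le_iff_right, ENNReal.div_le_iff' hr0 hrt]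
  refine iSup_le fun v => iSup_le fun hv => iSup_le fun hv0 => ?_
  have hv1 : ‖v‖ₑ ≠ 0 := enorm_ne_zero.2 hv0
  rw [ENNReal.div_le_iff hv1 enorm_ne_top]
  refine iSup_le fun γ => iSup_le fun hγ => ?_
  set X := PBA.condTheta r (∑ i, PBA.outer₃ (a i) (b i) (z i)) with hX
  have h1 : PBA.unordSpeed (PBA.factorTuples r n₁) (fun t => PBA.theta r (γ t)) ≤ X * ‖v‖ₑ := by
    rw [← ENNReal.div_le_iff hv1 enorm_ne_top]
    refine le_trans (ENNReal.div_le_div_right ?_ _)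
      (le_iSup_of_le v (le_iSup_of_le hv (le_iSup_of_le hv0 le_rfl)))
    exact le_iSup_of_le γ (le_iSup_of_le hγ le_rfl)
  -- The same curve `γ` serves both maps. The infimum over lifts is isolated on the right, so that
  -- the bound is checked lift by lift; with no lift it is `∞`.
  have h2 : PBA.unordSpeed (PBA.niceTuples r n₁ n₂ 2) (fun t => PBA.tdm r (γ t)) ≤
      10 * r * (PBA.unordSpeed (PBA.factorTuples r n₁) (fun t => PBA.theta r (γ t)) + ‖v‖ₑ) := by
    rw [mul_add, ← tsub_le_iff_right, ← ENNReal.div_le_iff' hr0 hrt]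
    refine le_iInf fun w => le_iInf fun ⟨y, p, hp, hlift⟩ => ?_
    rw [ENNReal.div_le_iff' hr0 hrt, tsub_le_iff_right, ← mul_add]
    exact PBA.unordSpeed_tdm_le hr hrn hν hν0.le ha hbz ha' haν hγ hp hlift
  refine h2.trans ?_
  rw [mul_assoc _ (X + 1), add_mul, one_mul]
  gcongr
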